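/- Let $\mathcal S\subset\mathbb Z^2$ be a finite set of steps $s=(|s|,\mathrm{alt}(s))$, each of positive length $|s|>0$, and let a finite automaton over the alphabet $\mathcal S$ be given by a finite set $Q$ of states, an initial state $q_0$, and a partial transition function $\delta:Q\times\mathcal S\rightharpoonup Q$. The walks are the finite words $w$ over $\mathcal S$ that the automaton can read completely from $q_0$; $|w|$ and $\mathrm{alt}(w)$ are the sums of the lengths and of the altitudes of the steps of $w$. Bridges are the walks with $\mathrm{alt}(w)=0$. Let $$W(t,u)=\sum_{w}t^{|w|}u^{\mathrm{alt}(w)},\qquad B(t)=\sum_{w\ \mathrm{bridge}}t^{|w|}$$ be the generating functions of walks (a power series in $t$ whose coefficients are Laurent polynomials in $u$) and of bridges. Let $A(t,u)$ be the matrix with entries $A_{ij}=\sum_{s:\,\delta(i,s)=j}t^{|s|}u^{\mathrm{alt}(s)}$, let $K(t,u)=\det(I-A(t,u))$ be the kernel, and write $W(t,u)$ also for the rational function $\frac{(1,0,\dots,0)\,\mathrm{adj}(I-A(t,u))\,\vec{\mathbf 1}}{K(t,u)}$, where the first coordinate is that of $q_0$. The small roots of the kernel are the distinct roots $u_1(t),\dots,u_e(t)\neq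 0$ of the Laurent polynomial $K(t,\cdot)$ that tend to $0$ as $t\to0$; for small $t\ne0$ they form a finite set. Then, as formal power series, $B(t)=[u^0]W(t,u)$. Moreover, for every $\varepsilon>0$ there is $\rho>0$ such that for all complex $t$ with $0<|t|<\rho$: $K(t,u)\neq0$ and the series $W(t,u)$ converges to the rational function $W(t,u)$ for all $|u|=\varepsilon$; the series $B(t)$ converges; and $$B(t)=\frac1{2\pi i}\oint_{|u|=\varepsilon}\frac{W(t,u)}{u}\,du=\mathrm{Res}_{u=0}\frac{W(t,u)}{u}+\sum_{i=1}^{e}\mathrm{Res}_{u=u_i(t)}\frac{W(t,u)}{u}.$$ In particular, whenever $u=0$ is not a pole of $W(t,u)/u$, $$B(t)=\frac1{2\pi i}\oint_{|u|=\varepsilon}\frac{W(t,u)}{u}\,du=\sum_{i=1}^{e}\mathrm{Res}_{u=u_i(t)}\frac{W(t,u)}{u}.$$ -/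

import Mathlib

open Filter Topology

noncomputable section

namespace LatticeWalk

/-- A finite automaton (without final states) over the step set `S`: an initial state and a
partial transition function, where `δ q s = none` means that the step `s` is forbidden
in the state `q`. The finite state set is `Q`. -/
structure Automaton (S : Finset (ℤ × ℤ)) (Q : Type*) where
  init : Q
  δ : Q → S → Option Q

/-- The length of a lattice path: the sum of the first coordinates of its steps. -/
def len {S : Finset (ℤ × ℤ)} (w : List S) : ℤ := (w.map fun s => s.1.1).sum

/-- The final altitude of a lattice path: the sum of the second coordinates of its steps. -/
def alt {S : Finset (ℤ × ℤ)} (w : List S) : ℤ := (w.map fun s => s.1.2).sum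

namespace Automaton

variable {S : Finset (ℤ × ℤ)} {Q : Type*}

/-- The walks obeying the constraint described by the automaton: the lattice paths that can be
read completely from the initial state. -/
def Walks (𝒜 : Automaton S Q) : Set (List S) :=
  {w | (w.foldlM 𝒜.δ 𝒜.init).isSome}

/-- There are only finitely many walks of a given length, as steps have positive length. -/
theorem finite_walks (hS : ∀ s ∈ S, 0 < s.1) (𝒜 : Automaton S Q) (n : ℕ) :
    {w | w ∈ 𝒜.Walks ∧ len w = n}.Finite := by
  refine (List.finite_length_le S n).subset ?_
  rintro w ⟨-, hw⟩
  have key : ∀ v : List S, (v.length : ℤ) ≤ len v := by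
    intro v
    induction v with
    | nil => simp [len]
    | cons s v ih =>
      have h := hS s.1 s.2
      simp only [len, List.map_cons, List.sum_cons, List.length_cons] at ih ⊢
      push_cast
      omega
  have := key w
  simp only [Set.mem_ofPred_eq]
  omega

/-- The bivariate generating function `W(t,u)` of walks, as a formal power series in `t` whose
coefficients are Laurent polynomials in `u`; `t` encodes length and `u` final altitude. -/
def walkGF (𝒜 : Automaton S Q) : PowerSeries (LaurentPolynomial ℂ) :=
  PowerSeries.mk fun n => ∑ᶠ w ∈ {w | w ∈ 𝒜.Walks ∧ len w = n}, LaurentPolynomial.T (alt w)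

/-- The generating function `B(t)` of bridges: the coefficient of `t ^ n` is the number of walks
of length `n` that end at altitude `0`. -/
def bridgeGF (𝒜 : Automaton S Q) : PowerSeries ℂ :=
  PowerSeries.mk fun n => (Set.ncard {w | w ∈ 𝒜.Walks ∧ len w = n ∧ alt w = 0} : ℂ)

variable [Fintype Q] [DecidableEq Q]

/-- The weighted adjacency matrix `A(t,u)`: the entry at `(i,j)` is the sum of `t^|s| u^alt(s)`
over the steps `s` that lead from the state `i` to the state `j`. -/
def adjMatrix (𝒜 : Automaton S Q) (t u : ℂ) : Matrix Q Q ℂ :=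
  Matrix.of fun i j => ∑ s : S, if 𝒜.δ i s = some j then t ^ s.1.1 * u ^ s.1.2 else 0

/-- The kernel `K(t,u) = det (I - A(t,u))`. -/
def kernel (𝒜 : Automaton S Q) (t u : ℂ) : ℂ :=
  (1 - 𝒜.adjMatrix t u).det

/-- The rational function `(1,0,…,0) adj(I - A(t,u)) 𝟏 / det(I - A(t,u))`, in which the first
coordinate is that of the initial state. -/
def walkFun (𝒜 : Automaton S Q) (t u : ℂ) : ℂ :=
  ((1 - 𝒜.adjMatrix t u).adjugate.mulVec (fun _ => 1)) 𝒜.init / 𝒜.kernel t u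

end Automaton

/-- `R t` is, for all small `t ≠ 0`, the set of values at `t` of the small roots of `K(t,u)`,
regarded as a Laurent polynomial in `u`: roots that tend to `0` as `t` tends to `0`, and all of
them. -/
structure IsSmallRoots (K : ℂ → ℂ → ℂ) (R : ℂ → Finset ℂ) : Prop where
  root : ∀ᶠ t in 𝓝[≠] (0 : ℂ), ∀ z ∈ R t, z ≠ 0 ∧ K t z = 0
  small : ∀ η > 0, ∀ᶠ t in 𝓝[≠] (0 : ℂ), ∀ z ∈ R t, ‖z‖ < η
  complete : ∃ r > 0, ∀ᶠ t in 𝓝[≠] (0 : ℂ), ∀ z, z ≠ 0 → ‖z‖ < r → K t z = 0 → z ∈ R t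

/-- The residue at `c` of a function with an isolated singularity there: the value of the integral
`(2πi)⁻¹ ∮ f` over all sufficiently small circles around `c`. -/
def residue (f : ℂ → ℂ) (c : ℂ) : ℂ :=
  limUnder (𝓝[>] (0 : ℝ)) fun r => (2 * Real.pi * Complex.I)⁻¹ * ∮ z in C(c, r), f z

end LatticeWalk

end

/-! Every step has positive length, so on an annulus `η ≤ ‖u‖ ≤ M` with `η > 0` the weights `t^|s|
u^alt(s)` tend uniformly to `0` as `t → 0`. Everything rests on their norms having sum less than
`1`. Then the series over all words converges absolutely, `I - A` is strictly diagonally dominant,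
hence `K ≠ 0`, and splitting off the first step shows that the series over words readable from each
state solve `(I - A) x = 1`; the adjugate identifies the series with the rational function
(`walkFun_eq_tsum`). On `‖u‖ = ε` the series of `W/u` may be integrated term by term, and only words
of altitude `0` survive.

As annuli are free of roots for small `t`, the nonzero roots in `‖u‖ < ε` are exactly the small
roots (`eventually_mem_smallRoots_iff`). The residue theorem, proved by removing principal parts one
at a time, then applies with singularities among `0` and these roots. -/

noncomputable section

namespace LatticeWalk

/-! ### Residues of meromorphic functions -/

/-- The integral of `f` over every sufficiently small circle around `c` is `2πi a`. -/
def HasResidueAt (f : ℂ → ℂ) (c a : ℂ) : Prop :=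
  ∀ᶠ r in 𝓝[>] (0 : ℝ), (∮ z in C(c, r), f z) = 2 * Real.pi * Complex.I * a

theorem HasResidueAt.residue_eq {f : ℂ → ℂ} {c a : ℂ} (h : HasResidueAt f c a) :
    residue f c = a := by
  refine Tendsto.limUnder_eq (tendsto_const_nhds.congr' ?_)
  filter_upwards [h] with r hr
  rw [hr, inv_mul_cancel_left₀ Complex.two_pi_I_ne_zero]

theorem eventually_forall_sphere {c : ℂ} {P : ℂ → Prop} (h : ∀ᶠ z in 𝓝[≠] c, P z) :
    ∀ᶠ r in 𝓝[>] (0 : ℝ), ∀ z ∈ Metric.sphere c r, P z := by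
  rw [eventually_nhdsWithin_iff, Metric.eventually_nhds_iff] at h
  obtain ⟨ε, hε, h⟩ := h
  filter_upwards [Ioo_mem_nhdsGT hε] with r hr z hz
  rw [Metric.mem_sphere] at hz
  exact h (hz ▸ hr.2) (dist_pos.1 (hz ▸ hr.1))

theorem hasResidueAt_zero_of_analyticAt {g : ℂ → ℂ} {c : ℂ} (hg : AnalyticAt ℂ g c) :
    HasResidueAt g c 0 := by
  obtain ⟨ε, hε, h⟩ := Metric.eventually_nhds_iff.1 hg.eventually_analyticAt
  filter_upwards [Ioo_mem_nhdsGT hε] with r hr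
  have hd : ∀ z ∈ Metric.closedBall c r, DifferentiableAt ℂ g z := fun z hz =>
    (h ((Metric.mem_closedBall.1 hz).trans_lt hr.2)).differentiableAt
  rw [mul_zero]
  exact Complex.circleIntegral_eq_zero_of_differentiable_on_off_countable hr.1.le
    Set.countable_empty (fun z hz => (hd z hz).continuousAt.continuousWithinAt)
    fun z hz => hd z (Metric.ball_subset_closedBall hz.1)

theorem HasResidueAt.of_eventuallyEq_add {f g p : ℂ → ℂ} {c a : ℂ} (hp : HasResidueAt p c a)
    (hpc : ∀ᶠ z in 𝓝[≠] c, ContinuousAt p z) (hg : AnalyticAt ℂ g c)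
    (hf : ∀ᶠ z in 𝓝[≠] c, f z = g z + p z) : HasResidueAt f c a := by
  have hgc : ∀ᶠ z in 𝓝[≠] c, ContinuousAt g z :=
    (hg.eventually_analyticAt.mono fun _ h => h.continuousAt).filter_mono nhdsWithin_le_nhds
  filter_upwards [hp, eventually_forall_sphere hpc, hasResidueAt_zero_of_analyticAt hg,
    eventually_forall_sphere hgc, eventually_forall_sphere hf, self_mem_nhdsWithin]
    with r h1 h2 h3 h4 h5 hr
  have hr : (0 : ℝ) < r := hr
  rw [circleIntegral.integral_congr hr.le h5, circleIntegral.integral_add, h1, h3]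
  · ring
  · exact ContinuousOn.circleIntegrable hr.le fun z hz => (h4 z hz).continuousWithinAt
  · exact ContinuousOn.circleIntegrable hr.le fun z hz => (h2 z hz).continuousWithinAt

/-- `p` is a principal part at `c` with residue `a`: it is holomorphic off `c` and its integral
over every circle around `c` is `2πi a`. -/
structure IsPrincipalPart (p : ℂ → ℂ) (c a : ℂ) : Prop where
  differentiableAt : ∀ z ≠ c, DifferentiableAt ℂ p z
  integral : ∀ w R, c ∈ Metric.ball w R → (∮ z in C(w, R), p z) = 2 * Real.pi * Complex.I * a

theorem IsPrincipalPart.circleIntegrable {p : ℂ → ℂ} {c a w : ℂ} {R : ℝ}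
    (h : IsPrincipalPart p c a) (hc : c ∈ Metric.ball w R) : CircleIntegrable p w R := by
  have hR : 0 < R := dist_nonneg.trans_lt hc
  refine ContinuousOn.circleIntegrable hR.le fun z hz => ?_
  refine (h.differentiableAt z ?_).continuousAt.continuousWithinAt
  rintro rfl
  exact (Metric.mem_ball.1 hc).ne hz

theorem IsPrincipalPart.add {p q : ℂ → ℂ} {c a b : ℂ} (hp : IsPrincipalPart p c a)
    (hq : IsPrincipalPart q c b) : IsPrincipalPart (fun z => p z + q z) c (a + b) where
  differentiableAt z hz := (hp.differentiableAt z hz).add (hq.differentiableAt z hz)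
  integral w R hc := by
    rw [circleIntegral.integral_add (hp.circleIntegrable hc) (hq.circleIntegrable hc),
      hp.integral w R hc, hq.integral w R hc]
    ring

theorem isPrincipalPart_zpow (b c : ℂ) (n : ℤ) :
    IsPrincipalPart (fun z => b * (z - c) ^ n) c (if n = -1 then b else 0) where
  differentiableAt z hz :=
    (((differentiableAt_id.sub_const c).zpow (Or.inl (sub_ne_zero.2 hz)))).const_mul b
  integral w R hc := by
    rw [circleIntegral.integral_const_mul]
    split_ifs with h
    · subst h
      simp only [zpow_neg_one]
      rw [circleIntegral.integral_sub_inv_of_mem_ball hc]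
      ring
    · rw [circleIntegral.integral_sub_zpow_of_ne h, mul_zero, mul_zero]

theorem IsPrincipalPart.hasResidueAt {p : ℂ → ℂ} {c a : ℂ} (h : IsPrincipalPart p c a) :
    HasResidueAt p c a := by
  filter_upwards [self_mem_nhdsWithin] with r hr
  exact h.integral c r (Metric.mem_ball_self hr)

/-- Since `h z = h c + (z - c) * dslope h c z`, each induction step splits off one Laurent term and
lowers the pole order by one. -/
theorem exists_isPrincipalPart_zpow_mul (c : ℂ) (n : ℕ) (h : ℂ → ℂ) (hh : AnalyticAt ℂ h c) :
    ∃ a p g, IsPrincipalPart p c a ∧ AnalyticAt ℂ g c ∧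
      ∀ z ≠ c, (z - c) ^ (-n : ℤ) * h z = g z + p z := by
  induction n generalizing h with
  | zero =>
    -- Coefficient `0` gives the zero principal part.
    exact ⟨_, _, h, isPrincipalPart_zpow 0 c 0, hh, fun z _ => by simp⟩
  | succ n ih =>
    have hd : AnalyticAt ℂ (dslope h c) c := by
      obtain ⟨q, hq⟩ := hh
      exact ⟨_, hq.has_fpower_series_dslope_fslope⟩
    obtain ⟨a, p, g, hp, hg, hfg⟩ := ih _ hd
    refine ⟨_, _, g, hp.add (isPrincipalPart_zpow (h c) c (-(n + 1 : ℕ))), hg, fun z hz => ?_⟩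
    have hz' : z - c ≠ 0 := sub_ne_zero.2 hz
    rw [← add_assoc, ← hfg z hz]
    have h1 : (z - c) ^ (-n : ℤ) = (z - c) ^ (-(n + 1 : ℕ) : ℤ) * (z - c) := by
      rw [← zpow_add_one₀ hz']
      push_cast
      ring_nf
    have h2 : (z - c) * dslope h c z = h z - h c := by
      simpa using sub_smul_dslope h c z
    rw [h1, mul_assoc, h2]
    ring

theorem exists_isPrincipalPart {f : ℂ → ℂ} {c : ℂ} (hf : MeromorphicAt f c) :
    ∃ a p g, IsPrincipalPart p c a ∧ AnalyticAt ℂ g c ∧ ∀ z ≠ c, f z = g z + p z := by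
  obtain ⟨n, hn⟩ := hf
  obtain ⟨a, p, g, hp, hg, h⟩ := exists_isPrincipalPart_zpow_mul c n _ hn
  refine ⟨a, p, g, hp, hg, fun z hz => ?_⟩
  rw [← h z hz, smul_eq_mul, ← mul_assoc, ← zpow_natCast, ← zpow_add₀ (sub_ne_zero.2 hz)]
  simp

theorem exists_hasResidueAt {f : ℂ → ℂ} {c : ℂ} (hf : MeromorphicAt f c) :
    ∃ a, HasResidueAt f c a := by
  obtain ⟨a, p, g, hp, hg, h⟩ := exists_isPrincipalPart hf
  refine ⟨a, hp.hasResidueAt.of_eventuallyEq_add ?_ hg ?_⟩ <;>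
    filter_upwards [self_mem_nhdsWithin] with z hz
  exacts [(hp.differentiableAt z hz).continuousAt, h z hz]

/-- The residue theorem on a disc, for a meromorphic function. -/
theorem circleIntegral_eq_sum_residue (w : ℂ) {R : ℝ} (hR : 0 < R) (T : Finset ℂ) (f : ℂ → ℂ)
    (hT : ∀ z ∈ T, z ∈ Metric.ball w R)
    (hd : ∀ z ∈ Metric.closedBall w R, z ∉ T → DifferentiableAt ℂ f z)
    (hm : ∀ z ∈ T, MeromorphicAt f z) :
    (∮ z in C(w, R), f z) = 2 * Real.pi * Complex.I * ∑ c ∈ T, residue f c := by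
  classical
  induction T using Finset.induction_on generalizing f with
  | empty =>
    rw [Finset.sum_empty, mul_zero]
    exact Complex.circleIntegral_eq_zero_of_differentiable_on_off_countable hR.le
      Set.countable_empty
      (fun z hz => (hd z hz (Finset.notMem_empty z)).continuousAt.continuousWithinAt)
      fun z hz => hd z (Metric.ball_subset_closedBall hz.1) (Finset.notMem_empty z)
  | insert c T hcT ih =>
    -- Replacing `f` by `g = f - p` removes the singularity at `c` and keeps the residues at the
    -- points of `T`, where `p` is analytic. The integral of `p` supplies the residue at `c`.
    obtain ⟨a, p, g, hp, hg, hfg⟩ := exists_isPrincipalPart (hm c (Finset.mem_insert_self c T))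
    have hcb := hT c (Finset.mem_insert_self c T)
    have hne : ∀ z ≠ c, g z = f z - p z := fun z hz => eq_sub_of_add_eq (hfg z hz).symm
    have hfar : ∀ z ≠ c, g =ᶠ[𝓝 z] fun z => f z - p z := fun z hz => by
      filter_upwards [isOpen_ne.mem_nhds hz] with y hy using hne y hy
    have hpa : ∀ z ≠ c, AnalyticAt ℂ p z := fun z hz =>
      DifferentiableOn.analyticAt (s := {c}ᶜ)
        (fun y hy => (hp.differentiableAt y hy).differentiableWithinAt)
        (isOpen_compl_singleton.mem_nhds hz)
    have hd₁ : ∀ z ∈ Metric.closedBall w R, z ∉ T → DifferentiableAt ℂ g z := by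
      intro z hz hzT
      rcases eq_or_ne z c with rfl | hzc
      · exact hg.differentiableAt
      · refine DifferentiableAt.congr_of_eventuallyEq ?_ (hfar z hzc)
        exact (hd z hz (by simp [hzc, hzT])).sub (hp.differentiableAt z hzc)
    have hm₁ : ∀ z ∈ T, MeromorphicAt g z := by
      intro z hz
      have hzc : z ≠ c := fun h => hcT (h ▸ hz)
      exact ((hm z (Finset.mem_insert_of_mem hz)).sub (hpa z hzc).meromorphicAt).congr
        ((hfar z hzc).symm.filter_mono nhdsWithin_le_nhds)
    have key := ih g (fun z hz => hT z (Finset.mem_insert_of_mem hz)) hd₁ hm₁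
    have hres : ∀ z ∈ T, residue g z = residue f z := by
      intro z hz
      have hzc : z ≠ c := fun h => hcT (h ▸ hz)
      obtain ⟨b, hb⟩ := exists_hasResidueAt (hm₁ z hz)
      rw [hb.residue_eq]
      refine (hb.of_eventuallyEq_add ?_ (hpa z hzc) ?_).residue_eq.symm
      · exact (hm₁ z hz).eventually_continuousAt
      · filter_upwards [(hfar z hzc).filter_mono nhdsWithin_le_nhds] with y hy
        rw [hy]
        ring
    have hresc : residue f c = a := by
      refine (hp.hasResidueAt.of_eventuallyEq_add ?_ hg ?_).residue_eq <;>
        filter_upwards [self_mem_nhdsWithin] with z hz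
      exacts [(hp.differentiableAt z hz).continuousAt, hfg z hz]
    rw [Finset.sum_insert hcT, hresc, ← Finset.sum_congr rfl hres, mul_add, ← key,
      ← hp.integral w R hcb, ← circleIntegral.integral_add (hp.circleIntegrable hcb)]
    · refine circleIntegral.integral_congr hR.le fun z hz => ?_
      have hzc : z ≠ c := by
        rintro rfl
        exact (Metric.mem_ball.1 hcb).ne hz
      simp only [hne z hzc]
      ring
    · refine ContinuousOn.circleIntegrable hR.le fun z hz => ?_
      refine (hd₁ z (Metric.sphere_subset_closedBall hz) fun hzT => ?_).continuousAt.continuousWithinAt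
      exact (Metric.mem_ball.1 (hT z (Finset.mem_insert_of_mem hzT))).ne hz

/-- The normal form of `f` is analytic at `c` and differs from `f` near `c` at most at `c` itself,
which small circles avoid. -/
theorem residue_eq_zero_of_meromorphicOrderAt_nonneg {f : ℂ → ℂ} {c : ℂ} (hf : MeromorphicAt f c)
    (h : 0 ≤ meromorphicOrderAt f c) : residue f c = 0 := by
  have hg := hf.meromorphicOrderAt_nonneg_iff_analyticAt_toMeromorphicNFAt.1 h
  refine (((isPrincipalPart_zpow 0 c 0).hasResidueAt.of_eventuallyEq_add ?_ hg ?_)).residue_eq.trans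
    (by simp)
  · simp [continuousAt_const]
  · filter_upwards [hf.eq_nhdsNE_toMeromorphicNFAt] with z hz
    simp [hz]

/-! ### Series over words and termwise integration -/

theorem summable_list_prod {α : Type*} [Fintype α] {x : α → ℝ} (h0 : ∀ a, 0 ≤ x a)
    (h1 : ∑ a, x a < 1) : Summable fun w : List α => (w.map x).prod := by
  rw [← List.equivSigmaTuple.symm.summable_iff, summable_sigma_of_nonneg]
  · refine ⟨fun n => Summable.of_finite, ?_⟩
    -- Grouping words by length gives a geometric series.
    have : ∀ n : ℕ, ∑' f : Fin n → α, ((List.ofFn f).map x).prod = (∑ a, x a) ^ n := fun n => by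
      rw [tsum_fintype]
      simp only [List.map_ofFn, List.prod_ofFn, Function.comp_apply]
      rw [← Fintype.prod_sum]
      simp
    refine (summable_geometric_of_lt_one (Finset.sum_nonneg fun a _ => h0 a) h1).congr fun n => ?_
    exact (this n).symm
  · intro f
    refine List.prod_nonneg fun y hy => ?_
    obtain ⟨a, -, rfl⟩ := List.mem_map.1 hy
    exact h0 a

/-- A list is either empty or consists of a head and a tail. -/
def listEquivSum (α : Type*) : Unit ⊕ (α × List α) ≃ List α where
  toFun := Sum.elim (fun _ => []) fun p => p.1 :: p.2
  invFun
    | [] => Sum.inl ()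
    | a :: w => Sum.inr (a, w)
  left_inv := by rintro (_ | _) <;> rfl
  right_inv := by rintro (_ | _) <;> rfl

theorem tsum_list {α : Type*} [Fintype α] {f : List α → ℂ} (hf : Summable f) :
    ∑' w, f w = f [] + ∑ a, ∑' w, f (a :: w) := by
  have h := (listEquivSum α).summable_iff.2 hf
  have hr : Summable fun p : α × List α => f (p.1 :: p.2) := h.comp_injective Sum.inr_injective
  rw [← (listEquivSum α).tsum_eq, Summable.tsum_sum Summable.of_finite hr]
  congr 1
  · simp [listEquivSum]
  · exact hr.tsum_prod.trans (tsum_fintype _)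

theorem hasSum_circleIntegral_of_summable_bound {ι : Type*} [Countable ι] {F : ι → ℂ → ℂ}
    {f : ℂ → ℂ} {c : ℂ} {R : ℝ} (hR : 0 ≤ R) {b : ι → ℝ} (hb : Summable b)
    (hF : ∀ i, ContinuousOn (F i) (Metric.sphere c R))
    (hFb : ∀ i, ∀ z ∈ Metric.sphere c R, ‖F i z‖ ≤ b i)
    (hf : ∀ z ∈ Metric.sphere c R, HasSum (fun i => F i z) (f z)) :
    HasSum (fun i => ∮ z in C(c, R), F i z) (∮ z in C(c, R), f z) := by
  have hm := circleMap_mem_sphere c hR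
  refine intervalIntegral.hasSum_integral_of_dominated_convergence (fun i _ => R * b i)
    (fun i => Continuous.aestronglyMeasurable ?_) (fun i => .of_forall fun θ _ => ?_)
    (.of_forall fun _ _ => hb.mul_left R) intervalIntegrable_const
    (.of_forall fun θ _ => (hf _ (hm θ)).const_smul _)
  · simp only [deriv_circleMap]
    exact ((continuous_circleMap 0 R).mul continuous_const).smul
      ((hF i).comp_continuous (continuous_circleMap c R) hm)
  · rw [norm_smul, deriv_circleMap, norm_mul, norm_circleMap_zero, Complex.norm_I, mul_one,
      abs_of_nonneg hR]
    exact mul_le_mul_of_nonneg_left (hFb i _ (hm θ)) hR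

/-! ### Walk series, rational function and contour integral -/

section

variable {S : Finset (ℤ × ℤ)} {Q : Type*}

/-- The weight `t^|s| u^alt(s)` of a step. -/
def stepWeight (t u : ℂ) (s : S) : ℂ := t ^ s.1.1 * u ^ s.1.2

theorem stepWeight_prod {t u : ℂ} (ht : t ≠ 0) (hu : u ≠ 0) (w : List S) :
    (w.map (stepWeight t u)).prod = t ^ len w * u ^ alt w := by
  induction w with
  | nil => simp [len, alt]
  | cons s w ih =>
    simp only [len, alt, List.map_cons, List.prod_cons, List.sum_cons] at ih ⊢
    rw [ih, zpow_add₀ ht, zpow_add₀ hu, stepWeight]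
    ring

theorem norm_stepWeight_prod (t u : ℂ) (w : List S) :
    ‖(w.map (stepWeight t u)).prod‖ = (w.map fun s => ‖stepWeight t u s‖).prod := by
  induction w with
  | nil => simp
  | cons s w ih => simp [ih]

theorem summable_stepWeight_prod {t u : ℂ} (h : ∑ s : S, ‖stepWeight t u s‖ < 1) :
    Summable fun w : List S => ‖(w.map (stepWeight t u)).prod‖ := by
  simp only [norm_stepWeight_prod]
  exact summable_list_prod (fun _ => norm_nonneg _) h

theorem len_nonneg (hS : ∀ s ∈ S, 0 < s.1) (w : List S) : 0 ≤ len w := by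
  refine List.sum_nonneg fun y hy => ?_
  obtain ⟨s, -, rfl⟩ := List.mem_map.1 hy
  exact (hS s.1 s.2).le

namespace Automaton

open Classical in
/-- The weight of a word, set to `0` when it cannot be read from the state `q`. -/
def wordWeight (𝒜 : Automaton S Q) (t u : ℂ) (q : Q) (w : List S) : ℂ :=
  if (w.foldlM 𝒜.δ q).isSome then (w.map (stepWeight t u)).prod else 0

theorem summable_wordWeight (𝒜 : Automaton S Q) {t u : ℂ}
    (h : ∑ s : S, ‖stepWeight t u s‖ < 1) (q : Q) : Summable (𝒜.wordWeight t u q) := by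
  refine (summable_stepWeight_prod h).of_norm_bounded fun w => ?_
  rw [wordWeight]
  split_ifs <;> simp

theorem wordWeight_cons (𝒜 : Automaton S Q) (t u : ℂ) (q : Q) (s : S) (w : List S) :
    𝒜.wordWeight t u q (s :: w) =
      stepWeight t u s * (𝒜.δ q s).elim 0 fun q' => 𝒜.wordWeight t u q' w := by
  cases h : 𝒜.δ q s <;> simp [wordWeight, List.foldlM_cons, h]

theorem coeff_bridgeGF (hS : ∀ s ∈ S, 0 < s.1) (𝒜 : Automaton S Q) (n : ℕ) :
    PowerSeries.coeff n 𝒜.bridgeGF = (PowerSeries.coeff n 𝒜.walkGF).coeff 0 := by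
  classical
  have hfin := finite_walks hS 𝒜 n
  rw [bridgeGF, walkGF, PowerSeries.coeff_mk, PowerSeries.coeff_mk,
    finsum_mem_eq_finite_toFinset_sum _ hfin, AddMonoidAlgebra.coeff_sum, Finsupp.finsetSum_apply]
  simp only [LaurentPolynomial.T_apply]
  rw [Finset.sum_boole, ← Set.ncard_coe_finset]
  congr 2
  ext w
  simp [and_assoc]

theorem hasSum_bridgeGF (hS : ∀ s ∈ S, 0 < s.1) (𝒜 : Automaton S Q) {t a : ℂ}
    (h : HasSum (fun w : 𝒜.Walks => if alt w.1 = 0 then t ^ len w.1 else 0) a) :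
    HasSum (fun n : ℕ => PowerSeries.coeff n 𝒜.bridgeGF * t ^ n) a := by
  classical
  have h' := (hasSum_subtype_iff_indicator
    (f := fun w : List S => if alt w = 0 then t ^ len w else 0)).1 h
  -- Lengths are nonnegative, so `toNat` merges no two of them.
  have h'' := h'.tsum_fiberwise fun w => (len w).toNat
  refine (congrArg (HasSum · a) (funext fun n => ?_)).mpr h''
  rw [tsum_subtype]
  trans ∑' w : {w | w ∈ 𝒜.Walks ∧ len w = n ∧ alt w = 0}, t ^ n
  · rw [tsum_const, bridgeGF, PowerSeries.coeff_mk, nsmul_eq_mul, Nat.card_coe_set_eq]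
  · rw [tsum_subtype _ fun _ => t ^ n]
    congr 1
    funext w
    have h0 := len_nonneg hS w
    have h1 : (len w).toNat = n ↔ len w = n := by omega
    simp only [Set.indicator_apply, Set.mem_preimage, Set.mem_singleton_iff, Set.mem_ofPred_eq, h1]
    by_cases h2 : len w = n
    · by_cases h3 : w ∈ 𝒜.Walks <;> simp [h2, h3]
    · simp [h2]

variable [Fintype Q] [DecidableEq Q]

/-- First-step decomposition: the empty word gives `1`, and a step `s` leads to the series of the
state `δ q s`, or to `0` if forbidden. -/
theorem one_sub_adjMatrix_mulVec_tsum (𝒜 : Automaton S Q) {t u : ℂ}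
    (h : ∑ s : S, ‖stepWeight t u s‖ < 1) :
    (1 - 𝒜.adjMatrix t u).mulVec (fun q => ∑' w, 𝒜.wordWeight t u q w) = fun _ => 1 := by
  funext q
  rw [Matrix.sub_mulVec, Matrix.one_mulVec, Pi.sub_apply, tsum_list (𝒜.summable_wordWeight h q),
    sub_eq_iff_eq_add]
  have hnil : 𝒜.wordWeight t u q [] = 1 := by simp [wordWeight]
  rw [hnil]
  congr 1
  simp only [Matrix.mulVec, dotProduct, adjMatrix, Matrix.of_apply, Finset.sum_mul]
  rw [Finset.sum_comm]
  refine Finset.sum_congr rfl fun s _ => ?_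
  simp only [wordWeight_cons, tsum_mul_left, ite_mul, zero_mul]
  cases 𝒜.δ q s <;> simp [stepWeight]

/-- Each step leads from `k` to at most one state, so every row of `A` has absolute sum below `1`
and `1 - A` is strictly diagonally dominant. -/
theorem kernel_ne_zero (𝒜 : Automaton S Q) {t u : ℂ} (h : ∑ s : S, ‖stepWeight t u s‖ < 1) :
    𝒜.kernel t u ≠ 0 := by
  refine det_ne_zero_of_sum_row_lt_diag fun k => ?_
  have hrow : ∑ j, ‖𝒜.adjMatrix t u k j‖ < 1 := by
    refine lt_of_le_of_lt ?_ h
    calc ∑ j, ‖𝒜.adjMatrix t u k j‖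
        ≤ ∑ j, ∑ s : S, if 𝒜.δ k s = some j then ‖stepWeight t u s‖ else 0 := by
          refine Finset.sum_le_sum fun j _ => (norm_sum_le _ _).trans (Finset.sum_le_sum fun s _ => ?_)
          split_ifs <;> simp [stepWeight]
      _ ≤ ∑ s : S, ‖stepWeight t u s‖ := by
          rw [Finset.sum_comm]
          refine Finset.sum_le_sum fun s _ => ?_
          cases 𝒜.δ k s <;> simp
  rw [← Finset.add_sum_erase _ _ (Finset.mem_univ k)] at hrow
  have hdiag : 1 - ‖𝒜.adjMatrix t u k k‖ ≤ ‖(1 - 𝒜.adjMatrix t u) k k‖ := by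
    simpa using norm_sub_norm_le (1 : ℂ) (𝒜.adjMatrix t u k k)
  have hoff : ∑ j ∈ Finset.univ.erase k, ‖(1 - 𝒜.adjMatrix t u) k j‖ =
      ∑ j ∈ Finset.univ.erase k, ‖𝒜.adjMatrix t u k j‖ := by
    refine Finset.sum_congr rfl fun j hj => ?_
    simp [Matrix.one_apply_ne (Finset.ne_of_mem_erase hj).symm]
  linarith

theorem walkFun_eq_tsum (𝒜 : Automaton S Q) {t u : ℂ} (h : ∑ s : S, ‖stepWeight t u s‖ < 1) :
    𝒜.walkFun t u = ∑' w, 𝒜.wordWeight t u 𝒜.init w := by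
  rw [walkFun, ← 𝒜.one_sub_adjMatrix_mulVec_tsum h, Matrix.mulVec_mulVec, Matrix.adjugate_mul,
    Matrix.smul_mulVec, Matrix.one_mulVec, Pi.smul_apply, smul_eq_mul]
  exact mul_div_cancel_left₀ _ (𝒜.kernel_ne_zero h)

theorem hasSum_walkFun (𝒜 : Automaton S Q) {t u : ℂ} (ht : t ≠ 0) (hu : u ≠ 0)
    (h : ∑ s : S, ‖stepWeight t u s‖ < 1) :
    HasSum (fun w : 𝒜.Walks => t ^ len w.1 * u ^ alt w.1) (𝒜.walkFun t u) := by
  classical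
  rw [walkFun_eq_tsum 𝒜 h]
  refine (hasSum_subtype_iff_indicator (f := fun w : List S => t ^ len w * u ^ alt w)).2 ?_
  convert (𝒜.summable_wordWeight h 𝒜.init).hasSum using 1
  funext w
  simp only [Set.indicator_apply, wordWeight, stepWeight_prod ht hu, Walks, Set.mem_ofPred_eq]

theorem hasSum_bridgeGF_circleIntegral (hS : ∀ s ∈ S, 0 < s.1) (𝒜 : Automaton S Q) {t : ℂ} {ε : ℝ}
    (ht : t ≠ 0) (hε : 0 < ε) (h : ∀ u : ℂ, ‖u‖ = ε → ∑ s : S, ‖stepWeight t u s‖ < 1) :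
    HasSum (fun n : ℕ => PowerSeries.coeff n 𝒜.bridgeGF * t ^ n)
      ((2 * Real.pi * Complex.I)⁻¹ * ∮ u in C(0, ε), 𝒜.walkFun t u / u) := by
  have hnorm : ∀ u ∈ Metric.sphere (0 : ℂ) ε, ‖u‖ = ε := fun u hu => by simpa using hu
  have hne : ∀ u ∈ Metric.sphere (0 : ℂ) ε, u ≠ 0 := fun u hu => by
    rw [← norm_pos_iff, hnorm u hu]; exact hε
  have hεn : ‖(ε : ℂ)‖ = ε := by simp [hε.le]
  have hε0 : (ε : ℂ) ≠ 0 := by exact_mod_cast hε.ne'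
  -- On the circle the norm of a term depends only on `‖u‖ = ε`, so the values at the point `u = ε`
  -- dominate; `ε⁻¹` comes from the division by `u`.
  have hb := ((summable_stepWeight_prod (h ε hεn)).subtype 𝒜.Walks).mul_right ε⁻¹
  have key := hasSum_circleIntegral_of_summable_bound hε.le hb
    (F := fun (w : 𝒜.Walks) u => t ^ len w.1 * u ^ alt w.1 / u)
    (f := fun u => 𝒜.walkFun t u / u) (c := 0) ?_ ?_ ?_
  · refine hasSum_bridgeGF hS 𝒜 ?_
    refine (congrArg (HasSum · _) (funext fun w => ?_)).mpr
      (key.mul_left (2 * Real.pi * Complex.I)⁻¹)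
    -- The integrand is the monomial `t^len * u^(alt - 1)`, whose residue vanishes unless `alt = 0`.
    have hint := (isPrincipalPart_zpow (t ^ len w.1) 0 (alt w.1 - 1)).integral 0 ε
      (Metric.mem_ball_self hε)
    rw [circleIntegral.integral_congr (g := fun u => t ^ len w.1 * (u - 0) ^ (alt w.1 - 1)) hε.le,
      hint, inv_mul_cancel_left₀ Complex.two_pi_I_ne_zero]
    · simp only [sub_eq_neg_self]
    · intro u hu
      simp only [sub_zero, zpow_sub_one₀ (hne u hu)]
      ring
  · intro w u hu
    have hu0 := hne u hu
    exact ((continuousAt_const.mul (continuousAt_zpow₀ _ _ (Or.inl hu0))).div₀ continuousAt_id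
      hu0).continuousWithinAt
  · intro w u hu
    simp only [Function.comp_apply, stepWeight_prod ht hε0, div_eq_mul_inv, norm_mul, norm_zpow,
      norm_inv, hnorm u hu, hεn]
    exact le_rfl
  · intro u hu
    exact (𝒜.hasSum_walkFun ht (hne u hu) (h u (hnorm u hu))).div_const u

end Automaton
end

/-! ### Regularity in `u` and location of the kernel's roots -/

theorem meromorphicAt_det {n : Type*} [Fintype n] [DecidableEq n] {A : ℂ → Matrix n n ℂ} {c : ℂ}
    (h : ∀ i j, MeromorphicAt (fun u => A u i j) c) : MeromorphicAt (fun u => (A u).det) c := by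
  simp only [Matrix.det_apply]
  exact MeromorphicAt.fun_sum fun σ _ =>
    (MeromorphicAt.fun_prod fun i _ => h _ _).const_smul _

theorem differentiableAt_det {n : Type*} [Fintype n] [DecidableEq n] {A : ℂ → Matrix n n ℂ} {c : ℂ}
    (h : ∀ i j, DifferentiableAt ℂ (fun u => A u i j) c) :
    DifferentiableAt ℂ (fun u => (A u).det) c := by
  simp only [Matrix.det_apply']
  exact DifferentiableAt.fun_sum fun σ _ =>
    (DifferentiableAt.fun_finsetProd fun i _ => h _ _).const_mul _

theorem meromorphicAt_adjugate {n : Type*} [Fintype n] [DecidableEq n] {A : ℂ → Matrix n n ℂ}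
    {c : ℂ} (h : ∀ i j, MeromorphicAt (fun u => A u i j) c) (i j : n) :
    MeromorphicAt (fun u => (A u).adjugate i j) c := by
  simp only [Matrix.adjugate_apply]
  refine meromorphicAt_det fun k l => ?_
  simp only [Matrix.updateRow_apply]
  split_ifs
  exacts [.const _ _, h k l]

theorem differentiableAt_adjugate {n : Type*} [Fintype n] [DecidableEq n] {A : ℂ → Matrix n n ℂ}
    {c : ℂ} (h : ∀ i j, DifferentiableAt ℂ (fun u => A u i j) c) (i j : n) :
    DifferentiableAt ℂ (fun u => (A u).adjugate i j) c := by
  simp only [Matrix.adjugate_apply]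
  refine differentiableAt_det fun k l => ?_
  simp only [Matrix.updateRow_apply]
  split_ifs
  exacts [differentiableAt_const _, h k l]

theorem eventually_sum_norm_stepWeight_lt_one {S : Finset (ℤ × ℤ)} (hS : ∀ s ∈ S, 0 < s.1)
    {η : ℝ} (hη : 0 < η) (M : ℝ) :
    ∀ᶠ t in 𝓝 (0 : ℂ), ∀ u : ℂ, η ≤ ‖u‖ → ‖u‖ ≤ M → ∑ s : S, ‖stepWeight t u s‖ < 1 := by
  -- `η^k + M^k` bounds `‖u‖^k` on the annulus for either sign of `k`; the factor `‖t‖^|s|` makes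
  -- the sum vanish at `t = 0`.
  have hlim : Tendsto (fun t : ℂ => ∑ s : S, ‖t‖ ^ s.1.1 * (η ^ s.1.2 + M ^ s.1.2)) (𝓝 0)
      (𝓝 (∑ s : S, ‖(0 : ℂ)‖ ^ s.1.1 * (η ^ s.1.2 + M ^ s.1.2))) :=
    tendsto_finsetSum _ fun s _ => ((continuousAt_id.norm.zpow₀ _
      (Or.inr (hS s.1 s.2).le)).mul continuousAt_const).tendsto
  have h0 : ∑ s : S, ‖(0 : ℂ)‖ ^ s.1.1 * (η ^ s.1.2 + M ^ s.1.2) = 0 :=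
    Finset.sum_eq_zero fun s _ => by rw [norm_zero, zero_zpow _ (hS s.1 s.2).ne', zero_mul]
  rw [h0] at hlim
  filter_upwards [hlim.eventually_lt_const one_pos] with t ht u h1 h2
  refine lt_of_le_of_lt (Finset.sum_le_sum fun s _ => ?_) ht
  have hu : 0 < ‖u‖ := hη.trans_le h1
  have hM : 0 < M := hu.trans_le h2
  rw [stepWeight, norm_mul, norm_zpow, norm_zpow]
  refine mul_le_mul_of_nonneg_left ?_ (zpow_nonneg (norm_nonneg t) _)
  rcases le_total 0 s.1.2 with h | h
  · exact (zpow_le_zpow_left₀ h hu.le h2).trans (le_add_of_nonneg_left (zpow_nonneg hη.le _))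
  · refine le_trans ?_ (le_add_of_nonneg_right (zpow_nonneg hM.le _))
    rw [← neg_neg s.1.2, zpow_neg, zpow_neg η]
    exact inv_anti₀ (zpow_pos hη _) (zpow_le_zpow_left₀ (neg_nonneg.2 h) hη.le h1)

namespace Automaton

variable {S : Finset (ℤ × ℤ)} {Q : Type*} [DecidableEq Q]

theorem meromorphicAt_one_sub_adjMatrix (𝒜 : Automaton S Q) (t c : ℂ) (i j : Q) :
    MeromorphicAt (fun u => (1 - 𝒜.adjMatrix t u) i j) c := by
  refine (MeromorphicAt.const _ c).fun_sub (MeromorphicAt.fun_sum fun s _ => ?_)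
  split_ifs
  · exact (MeromorphicAt.const _ c).fun_mul ((MeromorphicAt.id c).zpow _)
  · exact .const _ _

theorem differentiableAt_one_sub_adjMatrix (𝒜 : Automaton S Q) (t : ℂ) {c : ℂ} (hc : c ≠ 0)
    (i j : Q) : DifferentiableAt ℂ (fun u => (1 - 𝒜.adjMatrix t u) i j) c := by
  refine (differentiableAt_const _).sub (DifferentiableAt.fun_sum fun s _ => ?_)
  split_ifs
  · exact (differentiableAt_id.zpow (Or.inl hc)).const_mul _
  · exact differentiableAt_const _

variable [Fintype Q]

theorem meromorphicAt_walkFun_div (𝒜 : Automaton S Q) (t c : ℂ) :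
    MeromorphicAt (fun u => 𝒜.walkFun t u / u) c := by
  have h := 𝒜.meromorphicAt_one_sub_adjMatrix t c
  refine (MeromorphicAt.fun_div ?_ (meromorphicAt_det h)).fun_div (.id c)
  exact MeromorphicAt.fun_sum fun j _ => (meromorphicAt_adjugate h _ j).fun_mul (.const _ c)

theorem differentiableAt_walkFun_div (𝒜 : Automaton S Q) {t c : ℂ} (hc : c ≠ 0)
    (hK : 𝒜.kernel t c ≠ 0) : DifferentiableAt ℂ (fun u => 𝒜.walkFun t u / u) c := by
  have h := 𝒜.differentiableAt_one_sub_adjMatrix t hc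
  refine (DifferentiableAt.fun_div ?_ (differentiableAt_det h) hK).fun_div differentiableAt_id hc
  exact DifferentiableAt.fun_sum fun j _ =>
    (differentiableAt_adjugate h _ j).mul (differentiableAt_const _)

open Polynomial in
theorem finite_kernel_roots (𝒜 : Automaton S Q) {t v : ℂ} (hv : v ≠ 0) (hK : 𝒜.kernel t v ≠ 0) :
    {z | z ≠ 0 ∧ 𝒜.kernel t z = 0}.Finite := by
  -- Multiplying every entry of `I - A` by `u^N` clears the negative powers, so `u^(N * card Q) *
  -- K(t,u)` is a polynomial in `u`; it is nonzero because `K(t,v) ≠ 0`.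
  set N : ℕ := ∑ s : S, s.1.2.natAbs
  have hN : ∀ s : S, 0 ≤ (N : ℤ) + s.1.2 := fun s => by
    have : s.1.2.natAbs ≤ N :=
      Finset.single_le_sum (f := fun s : S => s.1.2.natAbs) (fun _ _ => Nat.zero_le _)
        (Finset.mem_univ s)
    omega
  set P : Matrix Q Q ℂ[X] := Matrix.of fun i j => X ^ N * C ((1 : Matrix Q Q ℂ) i j) -
    ∑ s : S, if 𝒜.δ i s = some j then C (t ^ s.1.1) * X ^ ((N : ℤ) + s.1.2).toNat else 0
  have hP : ∀ u : ℂ, u ≠ 0 → P.det.eval u = (u ^ N) ^ Fintype.card Q * 𝒜.kernel t u := by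
    intro u hu
    rw [kernel, ← Matrix.det_smul, ← coe_evalRingHom, RingHom.map_det]
    congr 1
    ext i j
    simp only [P, RingHom.mapMatrix_apply, Matrix.map_apply, Matrix.of_apply, coe_evalRingHom,
      eval_sub, eval_mul, eval_pow, eval_X, eval_C, eval_finsetSum, Matrix.smul_apply,
      Matrix.sub_apply, adjMatrix, smul_eq_mul, mul_sub, Finset.mul_sum]
    congr 1
    refine Finset.sum_congr rfl fun s _ => ?_
    split_ifs
    · rw [eval_mul, eval_C, eval_pow, eval_X, ← zpow_natCast, Int.toNat_of_nonneg (hN s),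
        zpow_add₀ hu, zpow_natCast]
      ring
    · simp
  have hP0 : P.det ≠ 0 := by
    intro h0
    have := hP v hv
    rw [h0, eval_zero, eq_comm] at this
    exact mul_ne_zero (pow_ne_zero _ (pow_ne_zero _ hv)) hK this
  refine P.det.roots.toFinset.finite_toSet.subset fun z hz => ?_
  rw [Finset.mem_coe, Multiset.mem_toFinset, mem_roots hP0, IsRoot, hP z hz.1, hz.2, mul_zero]

theorem eventually_kernel_ne_zero (hS : ∀ s ∈ S, 0 < s.1) (𝒜 : Automaton S Q)
    {η : ℝ} (hη : 0 < η) (M : ℝ) :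
    ∀ᶠ t in 𝓝[≠] (0 : ℂ), ∀ u : ℂ, η ≤ ‖u‖ → ‖u‖ ≤ M → 𝒜.kernel t u ≠ 0 :=
  ((eventually_sum_norm_stepWeight_lt_one hS hη M).filter_mono nhdsWithin_le_nhds).mono
    fun _ ht u h1 h2 => 𝒜.kernel_ne_zero (ht u h1 h2)

theorem exists_isSmallRoots (hS : ∀ s ∈ S, 0 < s.1) (𝒜 : Automaton S Q) :
    ∃ R : ℂ → Finset ℂ, IsSmallRoots 𝒜.kernel R := by
  classical
  have hfin : ∀ᶠ t in 𝓝[≠] (0 : ℂ), {z | z ≠ 0 ∧ ‖z‖ < 1 ∧ 𝒜.kernel t z = 0}.Finite := by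
    filter_upwards [𝒜.eventually_kernel_ne_zero hS one_pos 1] with t ht
    exact (𝒜.finite_kernel_roots one_ne_zero (ht 1 (by simp) (by simp))).subset
      fun z hz => ⟨hz.1, hz.2.2⟩
  set R : ℂ → Finset ℂ := fun t =>
    if h : {z | z ≠ 0 ∧ ‖z‖ < 1 ∧ 𝒜.kernel t z = 0}.Finite then h.toFinset else ∅
  have hR : ∀ᶠ t in 𝓝[≠] (0 : ℂ), ∀ z, z ∈ R t ↔ z ≠ 0 ∧ ‖z‖ < 1 ∧ 𝒜.kernel t z = 0 := by
    filter_upwards [hfin] with t ht z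
    simp only [R, dif_pos ht, Set.Finite.mem_toFinset, Set.mem_ofPred_eq]
  refine ⟨R, ?_, fun η hη => ?_, 1, one_pos, ?_⟩
  · filter_upwards [hR] with t ht z hz
    exact ⟨((ht z).1 hz).1, ((ht z).1 hz).2.2⟩
  · filter_upwards [hR, 𝒜.eventually_kernel_ne_zero hS hη 1] with t ht hK z hz
    obtain ⟨-, h1, h2⟩ := (ht z).1 hz
    by_contra! h
    exact hK z h h1.le h2
  · filter_upwards [hR] with t ht z h1 h2 h3
    exact (ht z).2 ⟨h1, h2, h3⟩

/-- For small `t`, the small roots are exactly the nonzero roots in a given disc. -/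
theorem eventually_mem_smallRoots_iff (hS : ∀ s ∈ S, 0 < s.1) (𝒜 : Automaton S Q)
    {R : ℂ → Finset ℂ} (hR : IsSmallRoots 𝒜.kernel R) {ε : ℝ} (hε : 0 < ε) :
    ∀ᶠ t in 𝓝[≠] (0 : ℂ), ∀ z, z ∈ R t ↔ z ≠ 0 ∧ ‖z‖ < ε ∧ 𝒜.kernel t z = 0 := by
  obtain ⟨r, hr, hc⟩ := hR.complete
  -- Completeness of `R` only reaches radius `r`; roots with `r ≤ ‖z‖ ≤ ε` are excluded by the
  -- annulus estimate.
  filter_upwards [hc, hR.root, hR.small ε hε, 𝒜.eventually_kernel_ne_zero hS hr ε]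
    with t h1 h2 h3 h4 z
  refine ⟨fun hz => ⟨(h2 z hz).1, h3 z hz, (h2 z hz).2⟩, fun ⟨hz, hzε, hK⟩ => h1 z hz ?_ hK⟩
  by_contra! h
  exact h4 z h hzε.le hK

theorem circleIntegral_walkFun_div (𝒜 : Automaton S Q) {t : ℂ} {ε : ℝ} (hε : 0 < ε) (T : Finset ℂ)
    (hT : ∀ z, z ∈ T ↔ z ≠ 0 ∧ ‖z‖ < ε ∧ 𝒜.kernel t z = 0)
    (hK : ∀ u : ℂ, ‖u‖ = ε → 𝒜.kernel t u ≠ 0) :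
    (2 * Real.pi * Complex.I)⁻¹ * (∮ u in C(0, ε), 𝒜.walkFun t u / u) =
      residue (fun u => 𝒜.walkFun t u / u) 0 +
        ∑ z ∈ T, residue (fun u => 𝒜.walkFun t u / u) z := by
  have h0 : (0 : ℂ) ∉ T := fun h => ((hT 0).1 h).1 rfl
  -- The point `0` joins the singular set because of the factor `1/u` and possible negative powers
  -- of `u`.
  rw [circleIntegral_eq_sum_residue 0 hε (Finset.cons 0 T h0), Finset.sum_cons,
    inv_mul_cancel_left₀ Complex.two_pi_I_ne_zero]
  · intro z hz
    rw [mem_ball_zero_iff]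
    rcases Finset.mem_cons.1 hz with rfl | hz
    · rwa [norm_zero]
    · exact ((hT z).1 hz).2.1
  · intro z hz hzT
    rw [mem_closedBall_zero_iff] at hz
    rw [Finset.mem_cons, not_or, hT] at hzT
    refine 𝒜.differentiableAt_walkFun_div hzT.1 fun h => ?_
    rcases hz.lt_or_eq with h1 | h1
    · exact hzT.2 ⟨hzT.1, h1, h⟩
    · exact hK z h1 h
  · exact fun z _ => 𝒜.meromorphicAt_walkFun_div t z

end Automaton

end LatticeWalk

end

theorem mainTheorem6 {Q : Type*} [Fintype Q] [DecidableEq Q]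
    (S : Finset (ℤ × ℤ)) (hS : ∀ s ∈ S, 0 < s.1) (𝒜 : LatticeWalk.Automaton S Q) :
    -- `B(t) = [u^0] W(t,u)`
    (∀ n : ℕ, PowerSeries.coeff n 𝒜.bridgeGF = (PowerSeries.coeff n 𝒜.walkGF).coeff 0) ∧
    -- the kernel has a finite set of small roots
    (∃ R : ℂ → Finset ℂ, LatticeWalk.IsSmallRoots 𝒜.kernel R) ∧
    (∀ R : ℂ → Finset ℂ, LatticeWalk.IsSmallRoots 𝒜.kernel R →
      ∀ ε : ℝ, 0 < ε → ∃ ρ : ℝ, 0 < ρ ∧ ∀ t : ℂ, 0 < ‖t‖ → ‖t‖ < ρ →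
        -- on the contour, `W(t,u)` converges to the rational function
        (∀ u : ℂ, ‖u‖ = ε → 𝒜.kernel t u ≠ 0 ∧
          HasSum (fun w : 𝒜.Walks => t ^ LatticeWalk.len w.1 * u ^ LatticeWalk.alt w.1)
            (𝒜.walkFun t u)) ∧
        -- `B(t)` is the contour integral
        HasSum (fun n : ℕ => PowerSeries.coeff n 𝒜.bridgeGF * t ^ n)
          ((2 * Real.pi * Complex.I)⁻¹ * ∮ u in C(0, ε), 𝒜.walkFun t u / u) ∧
        -- the contour integral is the sum of the residues at the small roots and at `0`
        MeromorphicAt (fun u => 𝒜.walkFun t u / u) 0 ∧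
        (2 * Real.pi * Complex.I)⁻¹ * (∮ u in C(0, ε), 𝒜.walkFun t u / u) =
          LatticeWalk.residue (fun u => 𝒜.walkFun t u / u) 0 +
            ∑ z ∈ R t, LatticeWalk.residue (fun u => 𝒜.walkFun t u / u) z ∧
        -- the residue at `0` is absent if `0` is not a pole
        (0 ≤ meromorphicOrderAt (fun u => 𝒜.walkFun t u / u) 0 →
          (2 * Real.pi * Complex.I)⁻¹ * (∮ u in C(0, ε), 𝒜.walkFun t u / u) =
            ∑ z ∈ R t, LatticeWalk.residue (fun u => 𝒜.walkFun t u / u) z)) := by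
  refine ⟨𝒜.coeff_bridgeGF hS, 𝒜.exists_isSmallRoots hS, fun R hR ε hε => ?_⟩
  obtain ⟨ρ, hρ, h⟩ := Metric.eventually_nhds_iff.1 (eventually_nhdsWithin_iff.1
    ((𝒜.eventually_mem_smallRoots_iff hS hR hε).and
      ((LatticeWalk.eventually_sum_norm_stepWeight_lt_one hS hε ε).filter_mono nhdsWithin_le_nhds)))
  refine ⟨ρ, hρ, fun t ht htρ => ?_⟩
  have ht0 : t ≠ 0 := norm_pos_iff.1 ht
  obtain ⟨hRt, hlt⟩ := h (by rwa [dist_zero_right]) ht0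
  have hsum : ∀ u : ℂ, ‖u‖ = ε → ∑ s : S, ‖LatticeWalk.stepWeight t u s‖ < 1 :=
    fun u hu => hlt u hu.ge hu.le
  have hK : ∀ u : ℂ, ‖u‖ = ε → 𝒜.kernel t u ≠ 0 := fun u hu => 𝒜.kernel_ne_zero (hsum u hu)
  have hm := 𝒜.meromorphicAt_walkFun_div t 0
  have hres := 𝒜.circleIntegral_walkFun_div hε (R t) hRt hK
  refine ⟨fun u hu => ⟨hK u hu, 𝒜.hasSum_walkFun ht0 ?_ (hsum u hu)⟩,
    𝒜.hasSum_bridgeGF_circleIntegral hS ht0 hε hsum, hm, hres, fun h0 => ?_⟩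
  · exact norm_pos_iff.1 (hu ▸ hε)
  · rw [hres, LatticeWalk.residue_eq_zero_of_meromorphicOrderAt_nonneg hm h0, zero_add]
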